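/- Let $r\ge 1$ and $n$ be integers with $r<n/2$. Let $\mathcal H$ be the space of real symmetric $n\times n$ matrices with the Frobenius inner product and norm $\|\cdot\|_F$, and let $\Sigma=\Sigma_r\subset\mathcal H$ be the set of matrices of rank at most $r$. Let $\mathcal C$ be the set of all functions $R:\mathcal H\to\mathbb R$ that are convex, continuous and coercive, and let $\|\cdot\|_*$ be the nuclear norm (the sum of the singular values). For $R\in\mathcal C$ let $$\mathcal T_R(\Sigma)=\bigcup_{x\in\Sigma}\{\gamma z:\gamma\in\mathbb R,\ z\in\mathcal H,\ R(x+z)\le R(x)\}$$ be the symmetrized descent cone. For a linear map $M$ on $\mathcal H$ let $$\delta_\Sigma(M)=\sup_{x\in(\Sigma-\Sigma)\setminus\{0\}}\left|\frac{\|Mx\|^2}{\|x\|_F^2}-1\right|,\qquad \gamma_\Sigma(M)=\frac{\sup\{\|Mx\|^2: x\in\Sigma-\Sigma,\ \|x\|_F=1\}}{\inf\{\|Mx\|^2: x\in\Sigma-\Sigma,\ \|x\|_F=1\}}\in[1,\infty]$$ (with $a/0=+\infty$) be its RIP constant and its restricted conditioning. For $z\neq0$ let $\Pi_z$ be the orthogonal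 projection onto $\mathrm{span}(z)$. Put $$\gamma^{\mathtt{nec}}_\Sigma(R)=\inf_{z\in\mathcal T_R(\Sigma)\setminus\{0\}}\gamma_\Sigma(I-\Pi_z),$$ and let $\delta^{\mathtt{nec}}_\Sigma(R)\in[0,1]$ be the RIP-type constant defined by $$\gamma^{\mathtt{nec}}_\Sigma(R)=\frac{1+\delta^{\mathtt{nec}}_\Sigma(R)}{1-\delta^{\mathtt{nec}}_\Sigma(R)},\qquad\text{i.e.}\qquad \delta^{\mathtt{nec}}_\Sigma(R)=\frac{\gamma^{\mathtt{nec}}_\Sigma(R)-1}{\gamma^{\mathtt{nec}}_\Sigma(R)+1}$$ (equal to $1$ if $\gamma^{\mathtt{nec}}_\Sigma(R)=\infty$). Then $\|\cdot\|_*\in\mathcal C$ and $$\delta^{\mathtt{nec}}_\Sigma(\|\cdot\|_*)=\sup_{R\in\mathcal C}\delta^{\mathtt{nec}}_\Sigma(R)=(2B^\star_{r,n}+1)^{-1},\qquad B^\star_{r,n}:=\max_{1\le L\le n-2r}\frac{L/r}{(L/r+1)^2+1},$$ where $L$ ranges over integers. Moreover the nuclear norm also maximizes the constant $\tilde\delta^{\mathtt{nec}}_\Sigma(R):=\inf_{z\in\mathcal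 T_R(\Sigma)\setminus\{0\}}\delta_\Sigma(I-\Pi_z)$, in which the operators are not rescaled: $$\tilde\delta^{\mathtt{nec}}_\Sigma(\|\cdot\|_*)=\sup_{R\in\mathcal C}\tilde\delta^{\mathtt{nec}}_\Sigma(R)=(B^\star_{r,n}+1)^{-1}.$$ -/

import Mathlib

open Set Filter Topology
open scoped Pointwise ENNReal

noncomputable section

namespace LowRank

section General

variable {H : Type*} [NormedAddCommGroup H] [InnerProductSpace ℝ H]

/-- The class of coercive continuous convex regularizers, finite everywhere on `H`. -/
def regularizers (H : Type*) [NormedAddCommGroup H] [InnerProductSpace ℝ H] : Set (H → ℝ) :=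
  {R | ConvexOn ℝ Set.univ R ∧ Continuous R ∧ Tendsto R (Bornology.cobounded H) atTop}

/-- The (symmetrized) descent cone of `R` at `x`. -/
def descentConeAt (R : H → ℝ) (x : H) : Set H :=
  {w | ∃ (γ : ℝ) (z : H), R (x + z) ≤ R x ∧ w = γ • z}

/-- The (symmetrized) descent cone of `R` on the model set `S`. -/
def descentCone (R : H → ℝ) (S : Set H) : Set H :=
  ⋃ x ∈ S, descentConeAt R x

/-- The RIP constant of `M` on the secant set `S - S` (the quotient is only formed for `x ≠ 0`). -/
def ripConst (S : Set H) {F : Type*} [NormedAddCommGroup F] [InnerProductSpace ℝ F]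
    (M : H →L[ℝ] F) : ℝ≥0∞ :=
  ⨆ x ∈ (S - S) \ {0}, ENNReal.ofReal |‖M x‖ ^ 2 / ‖x‖ ^ 2 - 1|

open Classical in
/-- The restricted conditioning of `M` on `S`, with the convention `a / 0 = ∞` for all `a ≥ 0`. -/
def restrictedCond (S : Set H) {F : Type*} [NormedAddCommGroup F] [InnerProductSpace ℝ F]
    (M : H →L[ℝ] F) : ℝ≥0∞ :=
  if (⨅ x ∈ (S - S) ∩ Metric.sphere (0 : H) 1, ENNReal.ofReal (‖M x‖ ^ 2)) = 0 then ⊤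
  else (⨆ x ∈ (S - S) ∩ Metric.sphere (0 : H) 1, ENNReal.ofReal (‖M x‖ ^ 2)) /
    (⨅ x ∈ (S - S) ∩ Metric.sphere (0 : H) 1, ENNReal.ofReal (‖M x‖ ^ 2))

/-- The operator `I - Π_z`, where `Π_z` is the orthogonal projection onto the span of `z`. -/
def coProj (z : H) : H →L[ℝ] H :=
  ContinuousLinearMap.id ℝ H - (Submodule.span ℝ {z}).starProjection

/-- `γ^nec`: the infimum of the restricted conditioning of `I - Π_z` over nonzero `z` in the
descent cone. -/
def gammaNec (S : Set H) (R : H → ℝ) : ℝ≥0∞ :=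
  ⨅ z ∈ descentCone R S \ {0}, restrictedCond S (coProj z)

open Classical in
/-- The RIP constant `δ ∈ [0, 1]` that corresponds to a restricted conditioning `γ ∈ [1, ∞]`, i.e.
the solution of `γ = (1 + δ) / (1 - δ)`. -/
def ripOfCond (γ : ℝ≥0∞) : ℝ≥0∞ :=
  if γ = ⊤ then 1 else (γ - 1) / (γ + 1)

/-- `δ^nec`, given by `γ^nec = (1 + δ^nec) / (1 - δ^nec)`. -/
def deltaNec (S : Set H) (R : H → ℝ) : ℝ≥0∞ :=
  ripOfCond (gammaNec S R)

/-- The variant of `δ^nec` without rescaling of the operators: the infimum of the RIP constants of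
the operators `I - Π_z` themselves. -/
def deltaNecUnscaled (S : Set H) (R : H → ℝ) : ℝ≥0∞ :=
  ⨅ z ∈ descentCone R S \ {0}, ripConst S (coProj z)

end General

/-- The Hilbert space of symmetric `n × n` real matrices with the Frobenius inner product, as a
subspace of the Euclidean space of all arrays `(v (i, j))`. -/
def SymMat (n : ℕ) : Submodule ℝ (EuclideanSpace ℝ (Fin n × Fin n)) where
  carrier := {v | ∀ i j, v (i, j) = v (j, i)}
  add_mem' := by
    intro a b ha hb i j
    simp [ha i j, hb i j]
  zero_mem' := by
    intro i j
    simp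
  smul_mem' := by
    intro c a ha i j
    simp [ha i j]

/-- The matrix with the entries of `A`. -/
def toMat {n : ℕ} (A : SymMat n) : Matrix (Fin n) (Fin n) ℝ :=
  Matrix.of fun i j => (A : EuclideanSpace ℝ (Fin n × Fin n)) (i, j)

/-- The symmetric matrices of rank at most `r`. -/
def lowRank (n r : ℕ) : Set (SymMat n) :=
  {A | (toMat A).rank ≤ r}

/-- The nuclear norm: the sum of the singular values. -/
def nuclearNorm {n : ℕ} (A : SymMat n) : ℝ :=
  ∑ i ∈ Finset.range n, (Matrix.toEuclideanLin (toMat A)).singularValues i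

/-- `B⋆_{r,n}`, the maximum over the integers `1 ≤ L ≤ n - 2 r`. -/
def Bstar (r n : ℕ) : ℝ :=
  sSup ((fun L : ℕ => ((L : ℝ) / r) / (((L : ℝ) / r + 1) ^ 2 + 1)) '' Set.Icc 1 (n - 2 * r))

end LowRank

end

/-! Since `‖(I - Π_z) x‖² = ‖x‖² - ⟪z, x⟫² / ‖z‖²`, both constants depend only on q(z), the supremum
of `⟪z, x⟫² / (‖z‖² ‖x‖²)` over nonzero secants x: the RIP constant is q, and the restricted
conditioning is 1/(1 - q) because some secant is orthogonal to z. The value q = 1/(B + 1)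
corresponds to δ = 1/(2B + 1), so both claims reduce to two bounds on q with B = `Bstar r n`.

For every convex R some descent direction has q ≤ 1/(B + 1) (`exists_descent_direction`). A
projection of rank L + 2r is an average of rank-r projections scaled by (L + 2r)/r, so by Jensen R
is at least as large at one of these as at the average. The difference z has eigenvalue -(L/r + 1)
with multiplicity r and 1 with multiplicity L + r. A secant has rank at most 2r and sees at most the
2r largest squared eigenvalues; optimizing over L gives B.

For the nuclear norm every descent direction has q ≥ 1/(B + 1) (`exists_secant_of_mem_descentCone`).
The inequality `sum_abs_eig_sub_le` passes from matrices to ordered eigenvalues, where descent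
forces r entries to dominate the rest in ℓ¹. Then 2r entries carry a fraction at least 1/(B + 1) of
the squared ℓ² norm (`exists_sum_sq_compl_le`), and truncating to the corresponding eigenvectors
gives the aligned secant. -/

noncomputable section

namespace LowRank

open Module
open scoped RealInnerProductSpace

/-! ### Eigenvalues and singular values of symmetric operators -/

section Spectral

variable {E : Type*} [NormedAddCommGroup E] [InnerProductSpace ℝ E] {n : ℕ}

/-- The quadratic form of an operator that is diagonal in an orthonormal basis. -/
theorem inner_apply_eq_sum_of_diagonal {ι : Type*} [Fintype ι] {T : E →ₗ[ℝ] E}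
    (hT : T.IsSymmetric) (b : OrthonormalBasis ι ℝ E) (l : ι → ℝ) (h : ∀ i, T (b i) = l i • b i)
    (v : E) : ⟪v, T v⟫ = ∑ i, l i * ⟪b i, v⟫ ^ 2 := by
  rw [← b.sum_inner_mul_inner]
  refine Finset.sum_congr rfl fun i _ => ?_
  rw [← hT, h, real_inner_smul_left, real_inner_comm v]
  ring

/-- The diagonal entries in any orthonormal basis are dominated by the eigenvalues in `ℓ¹`. -/
theorem sum_abs_inner_apply_le {ι κ : Type*} [Fintype ι] [Fintype κ] {T : E →ₗ[ℝ] E}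
    (hT : T.IsSymmetric) (b : OrthonormalBasis ι ℝ E) (l : ι → ℝ) (h : ∀ i, T (b i) = l i • b i)
    (f : OrthonormalBasis κ ℝ E) : ∑ k, |⟪f k, T (f k)⟫| ≤ ∑ i, |l i| := by
  calc ∑ k, |⟪f k, T (f k)⟫| ≤ ∑ k, ∑ i, |l i| * ⟪b i, f k⟫ ^ 2 := by
        refine Finset.sum_le_sum fun k _ => ?_
        rw [inner_apply_eq_sum_of_diagonal hT b l h]
        refine (Finset.abs_sum_le_sum_abs _ _).trans_eq (Finset.sum_congr rfl fun i _ => ?_)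
        rw [abs_mul, abs_of_nonneg (sq_nonneg ⟪b i, f k⟫)]
    _ = ∑ i, |l i| := by
        rw [Finset.sum_comm]
        refine Finset.sum_congr rfl fun i _ => ?_
        rw [← Finset.mul_sum, f.sum_sq_inner_left, b.norm_eq_one, one_pow, mul_one]

variable [FiniteDimensional ℝ E]

/-- Weyl's monotonicity principle. -/
theorem eigenvalues_le_of_inner_le {T S : E →ₗ[ℝ] E} (hT : T.IsSymmetric) (hS : S.IsSymmetric)
    (hn : finrank ℝ E = n) (h : ∀ v, ⟪v, T v⟫ ≤ ⟪v, S v⟫) (i : Fin n) :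
    hT.eigenvalues hn i ≤ hS.eigenvalues hn i := by
  set e := hT.eigenvectorBasis hn
  set f := hS.eigenvectorBasis hn
  -- These n - 1 functionals cut out span{e_j : j ≤ i} ∩ span{f_j : j ≥ i}, which is therefore
  -- nonzero; on it T is at least its i-th eigenvalue and S at most its own.
  let g : E →ₗ[ℝ] ({j : Fin n // j ≠ i} → ℝ) := LinearMap.pi fun j =>
    if i < j.1 then (innerₛₗ ℝ (e j.1)) else (innerₛₗ ℝ (f j.1))
  have hker : LinearMap.ker g ≠ ⊥ := by
    apply LinearMap.ker_ne_bot_of_finrank_lt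
    have := Fin.pos i
    simp [hn, Fintype.card_subtype_compl]
    omega
  obtain ⟨v, hv, hv0⟩ := (Submodule.ne_bot_iff _).1 hker
  have he : ∀ j, i < j → ⟪e j, v⟫ = 0 := fun j hj => by
    have := congrFun (LinearMap.mem_ker.1 hv) ⟨j, hj.ne'⟩
    simpa [g, hj] using this
  have hf : ∀ j, j < i → ⟪f j, v⟫ = 0 := fun j hj => by
    have := congrFun (LinearMap.mem_ker.1 hv) ⟨j, hj.ne⟩
    simpa [g, hj.not_gt] using this
  have h1 : hT.eigenvalues hn i * ‖v‖ ^ 2 ≤ ⟪v, T v⟫ := by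
    rw [inner_apply_eq_sum_of_diagonal hT e _ (hT.apply_eigenvectorBasis hn),
      ← e.sum_sq_inner_right, Finset.mul_sum]
    refine Finset.sum_le_sum fun j _ => ?_
    rcases lt_or_ge i j with hj | hj
    · simp [he j hj]
    · exact mul_le_mul_of_nonneg_right (hT.eigenvalues_antitone hn hj) (sq_nonneg _)
  have h2 : ⟪v, S v⟫ ≤ hS.eigenvalues hn i * ‖v‖ ^ 2 := by
    rw [inner_apply_eq_sum_of_diagonal hS f _ (hS.apply_eigenvectorBasis hn),
      ← f.sum_sq_inner_right, Finset.mul_sum]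
    refine Finset.sum_le_sum fun j _ => ?_
    rcases lt_or_ge j i with hj | hj
    · simp [hf j hj]
    · exact mul_le_mul_of_nonneg_right (hS.eigenvalues_antitone hn hj) (sq_nonneg _)
  exact le_of_mul_le_mul_right (h1.trans ((h v).trans h2)) (by positivity)

/-- The sum of the singular values of a symmetric operator is the `ℓ¹` norm of its eigenvalues. -/
theorem sum_singularValues_eq {ι : Type*} [Fintype ι] {T : E →ₗ[ℝ] E}
    (hT : T.IsSymmetric) (b : OrthonormalBasis ι ℝ E) (l : ι → ℝ) (h : ∀ i, T (b i) = l i • b i)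
    (hn : finrank ℝ E = n) :
    ∑ i ∈ Finset.range n, T.singularValues i = ∑ i, |l i| := by
  rw [Finset.sum_range]
  set g := T.isSymmetric_adjoint_comp_self.eigenvectorBasis hn
  have hg : ∀ k : Fin n, T (T (g k)) = T.singularValues k ^ 2 • g k := fun k => by
    have := T.isSymmetric_adjoint_comp_self.apply_eigenvectorBasis hn k
    rw [T.sq_singularValues_fin hn]
    exact (by rw [hT.adjoint_eq] : T (T (g k)) = T.adjoint (T (g k))).trans this
  -- `T²` is diagonal in both bases, so non-orthogonal b_i and g_k share an eigenvalue of `T²`. The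
  -- squared overlaps are doubly stochastic, which equates the two sums.
  have key : ∀ (k : Fin n) i, T.singularValues k * ⟪b i, g k⟫ ^ 2 = |l i| * ⟪b i, g k⟫ ^ 2 := by
    intro k i
    by_cases h0 : ⟪b i, g k⟫ = 0
    · simp [h0]
    · have : T.singularValues k ^ 2 * ⟪b i, g k⟫ = l i ^ 2 * ⟪b i, g k⟫ := by
        rw [← real_inner_smul_right, ← hg, ← hT, ← hT, h, map_smul, h, real_inner_smul_left,
          real_inner_smul_left]
        ring
      have := mul_right_cancel₀ h0 this
      rw [← sq_abs (l i)] at this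
      rw [(sq_eq_sq₀ (T.singularValues_nonneg k) (abs_nonneg _)).1 this]
  calc ∑ k : Fin n, T.singularValues k = ∑ k : Fin n, ∑ i, T.singularValues k * ⟪b i, g k⟫ ^ 2 := by
        refine Finset.sum_congr rfl fun k _ => ?_
        rw [← Finset.mul_sum, b.sum_sq_inner_right, g.norm_eq_one, one_pow, mul_one]
    _ = ∑ i, |l i| := by
        simp_rw [key]
        rw [Finset.sum_comm]
        refine Finset.sum_congr rfl fun i _ => ?_
        rw [← Finset.mul_sum, g.sum_sq_inner_left, b.norm_eq_one, one_pow, mul_one]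

end Spectral

/-! ### Symmetric matrices, their eigenvalues and the nuclear norm -/

section SymMat

variable {n : ℕ}

/-- The operator on Euclidean space given by a symmetric matrix. -/
def op : SymMat n →ₗ[ℝ] (EuclideanSpace ℝ (Fin n) →ₗ[ℝ] EuclideanSpace ℝ (Fin n)) where
  toFun A := Matrix.toEuclideanLin (toMat A)
  map_add' A B := by rw [← map_add]; rfl
  map_smul' c A := by rw [RingHom.id_apply, ← map_smul]; rfl

theorem op_apply_apply (A : SymMat n) (v : EuclideanSpace ℝ (Fin n)) (i : Fin n) :
    op A v i = ∑ j, A.1 (i, j) * v j := rfl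

theorem op_isSymmetric (A : SymMat n) : (op A).IsSymmetric := by
  refine Matrix.isSymmetric_toEuclideanLin_iff.2 ?_
  ext i j
  exact A.2 j i

theorem op_injective : Function.Injective (op (n := n)) := by
  intro A B h
  have : toMat A = toMat B := Matrix.toEuclideanLin.injective h
  ext ⟨i, j⟩
  exact congrFun (congrFun this i) j

theorem finrank_range_op (A : SymMat n) : finrank ℝ (LinearMap.range (op A)) = (toMat A).rank :=
  (Matrix.rank_eq_finrank_range_toLin (toMat A) (EuclideanSpace.basisFun (Fin n) ℝ).toBasis
    (EuclideanSpace.basisFun (Fin n) ℝ).toBasis).symm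

theorem mem_lowRank_iff {r : ℕ} {A : SymMat n} :
    A ∈ lowRank n r ↔ finrank ℝ (LinearMap.range (op A)) ≤ r := by
  rw [finrank_range_op]; rfl

/-- The Frobenius inner product in an arbitrary orthonormal basis. -/
theorem inner_eq_sum {ι : Type*} [Fintype ι] (f : OrthonormalBasis ι ℝ (EuclideanSpace ℝ (Fin n)))
    (A B : SymMat n) : ⟪A, B⟫ = ∑ k, ⟪op A (f k), op B (f k)⟫ := by
  have row : ∀ (C : SymMat n) (i : Fin n) (v : EuclideanSpace ℝ (Fin n)),
      op C v i = ⟪WithLp.toLp 2 fun j => C.1 (i, j), v⟫ := fun C i v => by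
    simp [op_apply_apply, PiLp.inner_apply, mul_comm]
  calc ⟪A, B⟫ = ∑ i, ⟪(WithLp.toLp 2 fun j => A.1 (i, j) : EuclideanSpace ℝ (Fin n)),
        WithLp.toLp 2 fun j => B.1 (i, j)⟫ := by
        rw [Submodule.coe_inner, PiLp.inner_apply, Fintype.sum_prod_type]
        simp [PiLp.inner_apply]
    _ = ∑ i, ∑ k, op A (f k) i * op B (f k) i := by
        refine Finset.sum_congr rfl fun i _ => ?_
        rw [← f.sum_inner_mul_inner]
        refine Finset.sum_congr rfl fun k _ => ?_
        rw [row, row, real_inner_comm (f k) (WithLp.toLp 2 fun j => B.1 (i, j))]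
    _ = ∑ k, ⟪op A (f k), op B (f k)⟫ := by
        rw [Finset.sum_comm]
        simp [PiLp.inner_apply, mul_comm]

/-- The matrix `v vᵀ`. -/
def outer (v : EuclideanSpace ℝ (Fin n)) : SymMat n :=
  ⟨WithLp.toLp 2 fun p => v p.1 * v p.2, fun _ _ => mul_comm _ _⟩

theorem op_outer (v u : EuclideanSpace ℝ (Fin n)) : op (outer v) u = ⟪v, u⟫ • v := by
  ext i
  simp [op_apply_apply, outer, PiLp.inner_apply, Finset.sum_mul]
  exact Finset.sum_congr rfl fun j _ => by ring

theorem inner_outer (A : SymMat n) (v : EuclideanSpace ℝ (Fin n)) :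
    ⟪A, outer v⟫ = ⟪v, op A v⟫ := by
  rw [inner_eq_sum (EuclideanSpace.basisFun (Fin n) ℝ), ← OrthonormalBasis.sum_inner_mul_inner
    (EuclideanSpace.basisFun (Fin n) ℝ) v (op A v)]
  refine Finset.sum_congr rfl fun k _ => ?_
  rw [op_outer, real_inner_smul_right, op_isSymmetric A]

/-- The trace of a symmetric matrix. -/
def tr : SymMat n →ₗ[ℝ] ℝ := LinearMap.trace ℝ _ ∘ₗ op

theorem tr_eq_sum {ι : Type*} [Fintype ι] (f : OrthonormalBasis ι ℝ (EuclideanSpace ℝ (Fin n)))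
    (A : SymMat n) : tr A = ∑ k, ⟪f k, op A (f k)⟫ :=
  LinearMap.trace_eq_sum_inner (op A) f

theorem tr_outer (v : EuclideanSpace ℝ (Fin n)) : tr (outer v) = ‖v‖ ^ 2 := by
  rw [tr_eq_sum (EuclideanSpace.basisFun (Fin n) ℝ),
    ← (EuclideanSpace.basisFun (Fin n) ℝ).sum_sq_inner_left]
  refine Finset.sum_congr rfl fun k _ => ?_
  rw [op_outer, real_inner_smul_right, real_inner_comm, sq]

/-- The eigenvalues of a symmetric matrix in decreasing order. -/
def eig (A : SymMat n) : Fin n → ℝ := (op_isSymmetric A).eigenvalues finrank_euclideanSpace_fin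

/-- An orthonormal basis of eigenvectors of a symmetric matrix. -/
def eigBasis (A : SymMat n) : OrthonormalBasis (Fin n) ℝ (EuclideanSpace ℝ (Fin n)) :=
  (op_isSymmetric A).eigenvectorBasis finrank_euclideanSpace_fin

theorem op_eigBasis (A : SymMat n) (i : Fin n) : op A (eigBasis A i) = eig A i • eigBasis A i :=
  (op_isSymmetric A).apply_eigenvectorBasis finrank_euclideanSpace_fin i

/-- The matrix with eigenvalues `l` on the orthonormal basis `b`, restricted to `s`. -/
def diagOn {ι : Type*} [Fintype ι] (b : OrthonormalBasis ι ℝ (EuclideanSpace ℝ (Fin n)))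
    (l : ι → ℝ) (s : Finset ι) : SymMat n :=
  ∑ i ∈ s, l i • outer (b i)

section diagOn

variable {ι : Type*} [Fintype ι] (b : OrthonormalBasis ι ℝ (EuclideanSpace ℝ (Fin n)))
    (l : ι → ℝ)

theorem op_diagOn (s : Finset ι) (v : EuclideanSpace ℝ (Fin n)) :
    op (diagOn b l s) v = ∑ i ∈ s, (l i * ⟪b i, v⟫) • b i := by
  simp [diagOn, map_sum, LinearMap.sum_apply, op_outer, smul_smul]

theorem op_diagOn_univ (i : ι) : op (diagOn b l Finset.univ) (b i) = l i • b i := by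
  classical
  rw [op_diagOn, Finset.sum_eq_single i] <;> simp +contextual [b.inner_eq_ite]

theorem inner_diagOn (A : SymMat n) (s : Finset ι) :
    ⟪diagOn b l s, A⟫ = ∑ i ∈ s, l i * ⟪b i, op A (b i)⟫ := by
  rw [diagOn, sum_inner]
  refine Finset.sum_congr rfl fun i _ => ?_
  rw [← inner_outer, real_inner_comm (outer (b i)) A]
  exact real_inner_smul_left (outer (b i)) A (l i)

theorem norm_sq_diagOn (s : Finset ι) : ‖diagOn b l s‖ ^ 2 = ∑ i ∈ s, l i ^ 2 := by
  classical
  rw [← real_inner_self_eq_norm_sq, inner_diagOn]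
  refine Finset.sum_congr rfl fun i hi => ?_
  rw [op_diagOn, inner_sum, Finset.sum_eq_single i] <;>
    simp +contextual [b.inner_eq_ite, real_inner_smul_right, hi, sq, eq_comm]

theorem tr_diagOn (s : Finset ι) : tr (diagOn b l s) = ∑ i ∈ s, l i := by
  simp [diagOn, tr_outer]

theorem diagOn_mem_lowRank {r : ℕ} {s : Finset ι} (hs : s.card ≤ r) :
    diagOn b l s ∈ lowRank n r := by
  classical
  rw [mem_lowRank_iff]
  have : LinearMap.range (op (diagOn b l s)) ≤
      Submodule.span ℝ ((s.image b : Finset _) : Set (EuclideanSpace ℝ (Fin n))) := by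
    rintro _ ⟨v, rfl⟩
    rw [op_diagOn]
    exact Submodule.sum_mem _ fun i hi => Submodule.smul_mem _ _
      (Submodule.subset_span (by simpa using ⟨i, hi, rfl⟩))
  exact (Submodule.finrank_mono this).trans
    ((finrank_span_finset_le_card _).trans (Finset.card_image_le.trans hs))

end diagOn

theorem diagOn_eig (A : SymMat n) : diagOn (eigBasis A) (eig A) Finset.univ = A := by
  apply op_injective
  apply (eigBasis A).toBasis.ext
  intro i
  rw [OrthonormalBasis.coe_toBasis, op_diagOn_univ, op_eigBasis]

theorem nuclearNorm_eq_sum {ι : Type*} [Fintype ι]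
    (b : OrthonormalBasis ι ℝ (EuclideanSpace ℝ (Fin n))) (l : ι → ℝ) (A : SymMat n)
    (h : ∀ i, op A (b i) = l i • b i) : nuclearNorm A = ∑ i, |l i| :=
  sum_singularValues_eq (op_isSymmetric A) b l h finrank_euclideanSpace_fin

theorem nuclearNorm_eq (A : SymMat n) : nuclearNorm A = ∑ i, |eig A i| :=
  nuclearNorm_eq_sum (eigBasis A) (eig A) A (op_eigBasis A)

theorem sum_abs_inner_op_le_nuclearNorm {ι : Type*} [Fintype ι]
    (f : OrthonormalBasis ι ℝ (EuclideanSpace ℝ (Fin n))) (A : SymMat n) :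
    ∑ i, |⟪f i, op A (f i)⟫| ≤ nuclearNorm A := by
  rw [nuclearNorm_eq]
  exact sum_abs_inner_apply_le (op_isSymmetric A) (eigBasis A) (eig A) (op_eigBasis A) f

/-- In an eigenbasis of A + B each eigenvalue is the sum of the diagonal entries of A and B, and the
diagonal of a matrix is bounded in ℓ¹ by its nuclear norm. -/
theorem nuclearNorm_add_le (A B : SymMat n) :
    nuclearNorm (A + B) ≤ nuclearNorm A + nuclearNorm B := by
  set f := eigBasis (A + B)
  refine le_trans ?_ (add_le_add (sum_abs_inner_op_le_nuclearNorm f A)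
    (sum_abs_inner_op_le_nuclearNorm f B))
  rw [nuclearNorm_eq, ← Finset.sum_add_distrib]
  refine Finset.sum_le_sum fun i _ => ?_
  have : eig (A + B) i = ⟪f i, op A (f i)⟫ + ⟪f i, op B (f i)⟫ := by
    rw [← inner_add_right, ← LinearMap.add_apply, ← map_add, op_eigBasis, real_inner_smul_right,
      real_inner_self_eq_norm_sq, f.norm_eq_one]
    simp
  rw [this]
  exact abs_add_le _ _

theorem nuclearNorm_smul (c : ℝ) (A : SymMat n) : nuclearNorm (c • A) = |c| * nuclearNorm A := by
  rw [nuclearNorm_eq A, Finset.mul_sum, nuclearNorm_eq_sum (eigBasis A) (fun i => c * eig A i)]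
  · simp [abs_mul]
  · intro i
    rw [map_smul, LinearMap.smul_apply, op_eigBasis, smul_smul]

theorem norm_le_nuclearNorm (A : SymMat n) : ‖A‖ ≤ nuclearNorm A := by
  have h : ‖A‖ ^ 2 ≤ nuclearNorm A ^ 2 := by
    conv_lhs => rw [← diagOn_eig A, norm_sq_diagOn]
    rw [nuclearNorm_eq]
    simp_rw [← sq_abs (eig A _)]
    exact Finset.sum_sq_le_sq_sum_of_nonneg fun i _ => abs_nonneg _
  exact le_of_sq_le_sq h (by rw [nuclearNorm_eq]; exact Finset.sum_nonneg fun i _ => abs_nonneg _)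

theorem nuclearNorm_mem_regularizers : (nuclearNorm (n := n)) ∈ regularizers (SymMat n) := by
  have hconv : ConvexOn ℝ Set.univ (nuclearNorm (n := n)) := by
    refine ⟨convex_univ, fun A _ B _ a b ha hb _ => (nuclearNorm_add_le _ _).trans_eq ?_⟩
    rw [nuclearNorm_smul, nuclearNorm_smul, abs_of_nonneg ha, abs_of_nonneg hb]
    rfl
  exact ⟨hconv, hconv.locallyLipschitz.continuous,
    tendsto_atTop_mono norm_le_nuclearNorm tendsto_norm_cobounded_atTop⟩

/-- The eigenvalues of symmetric matrices are nonexpansive from the nuclear norm to `ℓ¹`. -/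
theorem sum_abs_eig_sub_le (x y : SymMat n) :
    ∑ i, |eig x i - eig y i| ≤ nuclearNorm (x - y) := by
  set d := x - y
  set p := diagOn (eigBasis d) (fun i => max (eig d i) 0) Finset.univ
  set m := diagOn (eigBasis d) (fun i => max (-eig d i) 0) Finset.univ
  have hd : p - m = d := by
    conv_rhs => rw [← diagOn_eig d]
    simp only [p, m, diagOn, ← Finset.sum_sub_distrib, ← sub_smul]
    refine Finset.sum_congr rfl fun i _ => ?_
    congr 1
    rcases le_total (eig d i) 0 with h | h
    · rw [max_eq_right h, max_eq_left (by linarith)]; ring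
    · rw [max_eq_left h, max_eq_right (by linarith)]; ring
  have hnonneg : ∀ (l : Fin n → ℝ), (∀ i, 0 ≤ l i) → ∀ v,
      0 ≤ ⟪v, op (diagOn (eigBasis d) l Finset.univ) v⟫ := fun l hl v => by
    rw [inner_apply_eq_sum_of_diagonal (op_isSymmetric _) (eigBasis d) l (op_diagOn_univ _ _)]
    exact Finset.sum_nonneg fun i _ => mul_nonneg (hl i) (sq_nonneg _)
  -- Splitting d = p - m into positive and negative parts makes c = y + p = x + m dominate both x
  -- and y. Weyl monotonicity then replaces absolute values by linear expressions whose sum is a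
  -- trace.
  set c := y + p
  have hc : c = x + m := by
    have : p = x - y + m := by rw [← sub_eq_iff_eq_add, hd]
    simp only [c, this]; abel
  have hy : ∀ i, eig y i ≤ eig c i := eigenvalues_le_of_inner_le _ _ _ fun v => by
    have := hnonneg (fun i => max (eig d i) 0) (fun i => le_max_right _ _) v
    rw [map_add, LinearMap.add_apply, inner_add_right]
    linarith
  have hx : ∀ i, eig x i ≤ eig c i := eigenvalues_le_of_inner_le _ _ _ fun v => by
    have := hnonneg (fun i => max (-eig d i) 0) (fun i => le_max_right _ _) v
    rw [hc, map_add, LinearMap.add_apply, inner_add_right]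
    linarith
  have htr : ∀ A : SymMat n, ∑ i, eig A i = tr A := fun A => by
    conv_rhs => rw [← diagOn_eig A, tr_diagOn]
  calc ∑ i, |eig x i - eig y i| ≤ ∑ i, (2 * eig c i - eig x i - eig y i) := by
        refine Finset.sum_le_sum fun i _ => abs_le.2 ⟨?_, ?_⟩ <;> linarith [hx i, hy i]
    _ = (tr c - tr y) + (tr c - tr x) := by
        rw [Finset.sum_sub_distrib, Finset.sum_sub_distrib, ← Finset.mul_sum, htr, htr, htr]; ring
    _ = tr p + tr m := by
        nth_rw 2 [hc]
        simp only [c, map_add]; ring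
    _ = nuclearNorm d := by
        rw [nuclearNorm_eq, tr_diagOn, tr_diagOn, ← Finset.sum_add_distrib]
        refine Finset.sum_congr rfl fun i _ => ?_
        rcases le_total (eig d i) 0 with h | h
        · rw [max_eq_right h, max_eq_left (by linarith), abs_of_nonpos h]; ring
        · rw [max_eq_left h, max_eq_right (by linarith), abs_of_nonneg h]; ring

/-- Eigenvectors with nonzero eigenvalue lie in the range and are independent. -/
theorem card_eig_ne_zero_le {r : ℕ} {A : SymMat n} (hA : A ∈ lowRank n r) :
    (Finset.univ.filter fun i => eig A i ≠ 0).card ≤ r := by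
  rw [mem_lowRank_iff] at hA
  refine le_trans ?_ hA
  have hli : LinearIndependent ℝ
      (fun i : {i // eig A i ≠ 0} => (⟨eigBasis A i, (eig A i)⁻¹ • eigBasis A i, by
        rw [map_smul, op_eigBasis, smul_smul, inv_mul_cancel₀ i.2, one_smul]⟩ :
        LinearMap.range (op A))) := by
    apply LinearIndependent.of_comp (LinearMap.range (op A)).subtype
    exact (eigBasis A).orthonormal.linearIndependent.comp _ Subtype.val_injective
  have := hli.fintype_card_le_finrank
  rwa [Fintype.card_subtype] at this

end SymMat

/-! ### The extremal problem behind `Bstar` -/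

section Numeric

/-- The function maximized in `Bstar`. -/
def Bfun (r : ℕ) (L : ℕ) : ℝ := ((L : ℝ) / r) / (((L : ℝ) / r + 1) ^ 2 + 1)

variable {r n : ℕ}

theorem Bfun_le_Bstar {L : ℕ} (h1 : 1 ≤ L) (h2 : L ≤ n - 2 * r) : Bfun r L ≤ Bstar r n :=
  le_csSup ((Set.finite_Icc _ _).image _).bddAbove ⟨L, ⟨h1, h2⟩, rfl⟩

theorem exists_Bfun_eq_Bstar (hrn : 2 * r < n) :
    ∃ L, 1 ≤ L ∧ L ≤ n - 2 * r ∧ Bfun r L = Bstar r n := by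
  have hne : (Set.Icc 1 (n - 2 * r)).Nonempty := ⟨1, le_rfl, by omega⟩
  obtain ⟨L, hL, h⟩ := (hne.image (Bfun r)).csSup_mem ((Set.finite_Icc _ _).image _)
  exact ⟨L, hL.1, hL.2, h⟩

theorem Bfun_pos {L : ℕ} (hr : 1 ≤ r) (h1 : 1 ≤ L) : 0 < Bfun r L := by
  unfold Bfun
  have : (0 : ℝ) < r := by exact_mod_cast hr
  have : (0 : ℝ) < L := by exact_mod_cast h1
  positivity

theorem Bfun_le_one (L : ℕ) : Bfun r L ≤ 1 := by
  unfold Bfun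
  have : (0 : ℝ) ≤ (L : ℝ) / r := by positivity
  rw [div_le_one (by positivity)]
  nlinarith

theorem Bstar_pos (hr : 1 ≤ r) (hrn : 2 * r < n) : 0 < Bstar r n := by
  obtain ⟨L, h1, -, h⟩ := exists_Bfun_eq_Bstar hrn
  exact h ▸ Bfun_pos hr h1

/-- Together with r ≥ 1 this gives `Bstar r n / r ≤ 1`, the convexity condition in
`sum_sq_add_le_Bstar`. -/
theorem Bstar_le_one (hrn : 2 * r < n) : Bstar r n ≤ 1 := by
  obtain ⟨L, -, -, h⟩ := exists_Bfun_eq_Bstar hrn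
  exact h ▸ Bfun_le_one L

/-- The extremal inequality behind `Bstar`, on the unit cube. -/
theorem sum_sq_add_le_Bstar (hr : 1 ≤ r) (hrn : 2 * r < n) {ι : Type*} (v : ι → ℝ)
    (s : Finset ι) (k : ℕ) (hk : k + s.card ≤ n - 2 * r)
    (hv : ∀ i ∈ s, 0 ≤ v i ∧ v i ≤ 1) :
    ∑ i ∈ s, v i ^ 2 + k ≤ r * Bstar r n * (((∑ i ∈ s, v i + k) / r + 1) ^ 2 + 1) := by
  classical
  have hB := Bstar_pos hr hrn
  have hB1 := Bstar_le_one hrn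
  -- In each coordinate the left side has quadratic coefficient 1 and the right side B/r ≤ 1, so the
  -- difference is convex and is largest at an endpoint. The induction pushes coordinates to 0 or 1,
  -- with k counting the ones; at a vertex the claim is the definition of B.
  have hr1 : (1 : ℝ) ≤ r := by exact_mod_cast hr
  have hr0 : (0 : ℝ) < r := by linarith
  induction s using Finset.induction_on generalizing k with
  | empty =>
    simp only [Finset.sum_empty, zero_add, Finset.card_empty, add_zero] at hk ⊢
    rcases Nat.eq_zero_or_pos k with rfl | hk0
    · simp only [Nat.cast_zero]; positivity
    · have := Bfun_le_Bstar hk0 hk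
      rw [Bfun, div_le_iff₀ (by positivity), div_le_iff₀ hr0] at this
      linarith
  | insert a s ha ih =>
    rw [Finset.card_insert_of_notMem ha] at hk
    have h0 := ih k (by omega) fun i hi => hv i (Finset.mem_insert_of_mem hi)
    have h1 := ih (k + 1) (by omega) fun i hi => hv i (Finset.mem_insert_of_mem hi)
    obtain ⟨hva, hva'⟩ := hv a (Finset.mem_insert_self _ _)
    rw [Finset.sum_insert ha, Finset.sum_insert ha]
    push_cast at h1
    set S := ∑ i ∈ s, v i
    set Q := ∑ i ∈ s, v i ^ 2
    set t := v a
    have e : r * Bstar r n * (((t + S + k) / r + 1) ^ 2 + 1) =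
        (1 - t) * (r * Bstar r n * (((S + k) / r + 1) ^ 2 + 1))
        + t * (r * Bstar r n * (((S + (k + 1)) / r + 1) ^ 2 + 1))
        - Bstar r n / r * (t * (1 - t)) := by
      field_simp
      ring
    have hq : Bstar r n / r ≤ 1 := by
      rw [div_le_one hr0]; linarith
    have := mul_le_mul_of_nonneg_right hq (mul_nonneg hva (sub_nonneg.2 hva'))
    rw [e]
    linarith [mul_le_mul_of_nonneg_left h0 (sub_nonneg.2 hva'),
      mul_le_mul_of_nonneg_left h1 hva]

/-- The homogeneous form of the extremal inequality. -/
theorem sum_sq_le_Bstar (hr : 1 ≤ r) (hrn : 2 * r < n) {ι : Type*} (v : ι → ℝ)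
    (s : Finset ι) (hs : s.card ≤ n - 2 * r) {t : ℝ} (ht : 0 ≤ t)
    (hv : ∀ i ∈ s, 0 ≤ v i ∧ v i ≤ t) :
    ∑ i ∈ s, v i ^ 2 ≤ Bstar r n * ((∑ i ∈ s, v i + r * t) ^ 2 / r + r * t ^ 2) := by
  have hB := Bstar_pos hr hrn
  have hr0 : (0 : ℝ) < r := by exact_mod_cast hr
  rcases ht.eq_or_lt with rfl | ht
  · rw [Finset.sum_eq_zero fun i hi => by
      rw [le_antisymm (hv i hi).2 (hv i hi).1, zero_pow two_ne_zero]]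
    positivity
  · have := sum_sq_add_le_Bstar hr hrn (fun i => v i / t) s 0 (by simpa using hs) fun i hi =>
      ⟨div_nonneg (hv i hi).1 ht.le, (div_le_one ht).2 (hv i hi).2⟩
    simp only [div_pow, ← Finset.sum_div, Nat.cast_zero, add_zero] at this
    rw [div_le_iff₀ (by positivity)] at this
    refine this.trans_eq ?_
    field_simp

/-- The `k` largest values of a function on a finite set. -/
theorem exists_top_subset {ι : Type*} [DecidableEq ι] (a : ι → ℝ) (s : Finset ι) (k : ℕ)
    (hk : k ≤ s.card) : ∃ T ⊆ s, T.card = k ∧ ∀ i ∈ T, ∀ j ∈ s \ T, a j ≤ a i := by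
  induction k with
  | zero => exact ⟨∅, by simp, by simp, by simp⟩
  | succ k ih =>
    obtain ⟨T, hTs, hT, h⟩ := ih (by omega)
    have hne : (s \ T).Nonempty := by
      rw [← Finset.card_pos, Finset.card_sdiff_of_subset hTs]; omega
    obtain ⟨m, hm, hmax⟩ := Finset.exists_max_image (s \ T) a hne
    rw [Finset.mem_sdiff] at hm
    refine ⟨insert m T, Finset.insert_subset hm.1 hTs, by
      rw [Finset.card_insert_of_notMem hm.2, hT], fun i hi j hj => ?_⟩
    have hj' : j ∈ s \ T := by
      rw [Finset.mem_sdiff, Finset.mem_insert, not_or] at hj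
      exact Finset.mem_sdiff.2 ⟨hj.1, hj.2.2⟩
    rcases Finset.mem_insert.1 hi with rfl | hi
    · exact hmax j hj'
    · exact h i hi j hj'

/-- If `r` entries dominate the rest in `ℓ¹`, then `2 r` entries dominate the rest in `ℓ²` up to
the constant `Bstar`. -/
theorem exists_sum_sq_compl_le (hr : 1 ≤ r) (hrn : 2 * r < n) (a : Fin n → ℝ)
    (ha : ∀ i, 0 ≤ a i) (I : Finset (Fin n)) (hI : I.card ≤ r)
    (h : ∑ i ∈ Iᶜ, a i ≤ ∑ i ∈ I, a i) :
    ∃ T₀ T₁ : Finset (Fin n), Disjoint T₀ T₁ ∧ T₀.card = r ∧ T₁.card = r ∧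
      ∑ i ∈ (T₀ ∪ T₁)ᶜ, a i ^ 2 ≤ Bstar r n * ∑ i ∈ T₀ ∪ T₁, a i ^ 2 := by
  have hr0 : (0 : ℝ) < r := by exact_mod_cast hr
  have hB := Bstar_pos hr hrn
  obtain ⟨T₀, hIT, -, hT₀⟩ := Finset.exists_subsuperset_card_eq (Finset.subset_univ I) hI
    (by simp; omega)
  obtain ⟨T₁, hT₁s, hT₁, htop⟩ := exists_top_subset a T₀ᶜ r
    (by rw [Finset.card_compl, hT₀, Fintype.card_fin]; omega)
  have hdisj : Disjoint T₀ T₁ := by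
    rw [Finset.disjoint_left]
    exact fun i h0 h1 => Finset.mem_compl.1 (hT₁s h1) h0
  refine ⟨T₀, T₁, hdisj, hT₀, hT₁, ?_⟩
  -- The mean over T₁, the r largest entries outside T₀, bounds every remaining entry.
  -- Cauchy–Schwarz on T₀ and T₁ then turns the two terms of `sum_sq_le_Bstar` into sums of squares.
  set t := (∑ i ∈ T₁, a i) / r with ht
  have htr : r * t = ∑ i ∈ T₁, a i := by rw [ht]; field_simp
  have ht0 : 0 ≤ t := div_nonneg (Finset.sum_nonneg fun i _ => ha i) hr0.le
  have hcompl : (T₀ ∪ T₁)ᶜ = T₀ᶜ \ T₁ := by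
    ext i; simp
  have hle : ∑ i ∈ (T₀ ∪ T₁)ᶜ, a i + r * t ≤ ∑ i ∈ T₀, a i := by
    rw [htr, hcompl, Finset.sum_sdiff hT₁s]
    exact (Finset.sum_le_sum_of_subset_of_nonneg (Finset.compl_subset_compl.2 hIT)
      fun i _ _ => ha i).trans (h.trans
      (Finset.sum_le_sum_of_subset_of_nonneg hIT fun i _ _ => ha i))
  have hmain := sum_sq_le_Bstar hr hrn a (T₀ ∪ T₁)ᶜ
    (by rw [Finset.card_compl, Finset.card_union_of_disjoint hdisj, Fintype.card_fin]; omega)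
    ht0 fun j hj => ⟨ha j, by
      rw [ht, le_div_iff₀ hr0, mul_comm, ← hT₁, ← nsmul_eq_mul]
      exact Finset.card_nsmul_le_sum _ _ _ fun i hi => htop i hi j (hcompl ▸ hj)⟩
  refine hmain.trans (mul_le_mul_of_nonneg_left ?_ hB.le)
  rw [Finset.sum_union hdisj]
  have c0 := sq_sum_le_card_mul_sum_sq (s := T₀) (f := a)
  have c1 := sq_sum_le_card_mul_sum_sq (s := T₁) (f := a)
  rw [hT₀] at c0
  rw [hT₁, ← htr] at c1
  refine add_le_add ?_ ?_
  · rw [div_le_iff₀ hr0]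
    refine le_trans ?_ (c0.trans_eq (mul_comm _ _))
    exact pow_le_pow_left₀ (add_nonneg (Finset.sum_nonneg fun i _ => ha i) (by positivity)) hle 2
  · refine le_of_mul_le_mul_left ?_ hr0
    calc (r : ℝ) * (r * t ^ 2) = (r * t) ^ 2 := by ring
      _ ≤ _ := c1

end Numeric

/-! ### Both constants of I - Π_z in terms of alignment with secants -/

section Constants

theorem ripOfCond_mono : Monotone ripOfCond := by
  intro a b hab
  unfold ripOfCond
  have key : ∀ c : ℝ≥0∞, (c - 1) / (c + 1) ≤ 1 := fun c =>
    ENNReal.div_le_of_le_mul (by rw [one_mul]; exact tsub_le_self.trans le_self_add)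
  by_cases hb : b = ⊤
  · rw [if_pos hb]
    split_ifs
    · exact le_rfl
    · exact key a
  have ha : a ≠ ⊤ := ne_top_of_le_ne_top hb hab
  rw [if_neg hb, if_neg ha]
  rcases le_total a 1 with h1 | h1
  · simp [tsub_eq_zero_of_le h1]
  lift a to NNReal using ha
  lift b to NNReal using hb
  have h1' : (1 : NNReal) ≤ a := by exact_mod_cast h1
  have hab' : a ≤ b := by exact_mod_cast hab
  have e : ∀ c : NNReal, ((c : ℝ≥0∞) - 1) / (c + 1) = (((c - 1) / (c + 1) : NNReal) : ℝ≥0∞) := by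
    intro c
    rw [ENNReal.coe_div (by positivity), ENNReal.coe_sub]; simp
  rw [e, e, ENNReal.coe_le_coe, div_le_div_iff₀ (by positivity) (by positivity), ← NNReal.coe_le_coe]
  push_cast [NNReal.coe_sub h1', NNReal.coe_sub (h1'.trans hab')]
  have : (a : ℝ) ≤ b := by exact_mod_cast hab'
  nlinarith

/-- Converts q = 1/(B + 1) into the rescaled constant, via γ = 1/(1 - q) = 1 + 1/B. -/
theorem ripOfCond_ofReal {B : ℝ} (hB : 0 < B) :
    ripOfCond (ENNReal.ofReal (1 / (1 - (B + 1)⁻¹))) = ENNReal.ofReal (2 * B + 1)⁻¹ := by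
  have h : 1 / (1 - (B + 1)⁻¹) = 1 + 1 / B := by
    have : B + 1 - 1 ≠ 0 := by simpa using hB.ne'
    field_simp
    ring
  have hB' : 0 < 1 / B := by positivity
  rw [ripOfCond, if_neg ENNReal.ofReal_ne_top, h, ← ENNReal.ofReal_one,
    ← ENNReal.ofReal_sub _ zero_le_one, ← ENNReal.ofReal_add (by positivity) zero_le_one,
    ← ENNReal.ofReal_div_of_pos (by positivity)]
  congr 1
  field_simp
  ring

variable {H : Type*} [NormedAddCommGroup H] [InnerProductSpace ℝ H] {S : Set H} {z : H} {q : ℝ}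

theorem norm_sq_coProj_apply (z x : H) :
    ‖coProj z x‖ ^ 2 = ‖x‖ ^ 2 - ⟪z, x⟫ ^ 2 / ‖z‖ ^ 2 := by
  have : coProj z x = x - (⟪z, x⟫ / ‖z‖ ^ 2) • z := by
    simp [coProj, Submodule.starProjection_singleton]
  rw [this, norm_sub_sq_real, real_inner_smul_right, norm_smul, real_inner_comm]
  by_cases hz : ‖z‖ = 0
  · simp [hz]
  · rw [mul_pow, Real.norm_eq_abs, sq_abs]
    field_simp
    ring

theorem ripConst_coProj (S : Set H) (hz : z ≠ 0) :
    ripConst S (coProj z) =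
      ⨆ x ∈ (S - S) \ {0}, ENNReal.ofReal (⟪z, x⟫ ^ 2 / (‖z‖ ^ 2 * ‖x‖ ^ 2)) := by
  refine biSup_congr fun x hx => ?_
  have hx0 : ‖x‖ ≠ 0 := norm_ne_zero_iff.2 hx.2
  have hz0 : ‖z‖ ≠ 0 := norm_ne_zero_iff.2 hz
  rw [norm_sq_coProj_apply]
  have : (‖x‖ ^ 2 - ⟪z, x⟫ ^ 2 / ‖z‖ ^ 2) / ‖x‖ ^ 2 - 1 =
      -(⟪z, x⟫ ^ 2 / (‖z‖ ^ 2 * ‖x‖ ^ 2)) := by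
    field_simp
    ring
  rw [this, abs_neg, abs_of_nonneg (by positivity)]

theorem ripConst_coProj_le (hz : z ≠ 0)
    (h : ∀ x ∈ S - S, ⟪z, x⟫ ^ 2 ≤ q * (‖z‖ ^ 2 * ‖x‖ ^ 2)) :
    ripConst S (coProj z) ≤ ENNReal.ofReal q := by
  rw [ripConst_coProj S hz]
  refine iSup₂_le fun x hx => ENNReal.ofReal_le_ofReal ?_
  have hx0 : 0 < ‖x‖ := norm_pos_iff.2 hx.2
  have hz0 : 0 < ‖z‖ := norm_pos_iff.2 hz
  rw [div_le_iff₀ (by positivity)]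
  exact h x hx.1

theorem le_ripConst_coProj (hz : z ≠ 0) {x : H} (hx : x ∈ S - S) (hx0 : x ≠ 0)
    (h : q * (‖z‖ ^ 2 * ‖x‖ ^ 2) ≤ ⟪z, x⟫ ^ 2) :
    ENNReal.ofReal q ≤ ripConst S (coProj z) := by
  rw [ripConst_coProj S hz]
  refine le_iSup₂_of_le x ⟨hx, hx0⟩ (ENNReal.ofReal_le_ofReal ?_)
  have hx0 : 0 < ‖x‖ := norm_pos_iff.2 hx0
  have hz0 : 0 < ‖z‖ := norm_pos_iff.2 hz
  rw [le_div_iff₀ (by positivity)]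
  exact h

/-- On unit secants the squared norm lies between 1 - q and 1; q < 1 keeps the infimum away from the
degenerate value 0. -/
theorem restrictedCond_coProj_le (hz : z ≠ 0) (hq : q < 1)
    (h : ∀ x ∈ S - S, ⟪z, x⟫ ^ 2 ≤ q * (‖z‖ ^ 2 * ‖x‖ ^ 2)) :
    restrictedCond S (coProj z) ≤ ENNReal.ofReal (1 / (1 - q)) := by
  have hz0 : 0 < ‖z‖ := norm_pos_iff.2 hz
  have hinf : ENNReal.ofReal (1 - q) ≤
      ⨅ x ∈ (S - S) ∩ Metric.sphere (0 : H) 1, ENNReal.ofReal (‖coProj z x‖ ^ 2) := by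
    refine le_iInf₂ fun x hx => ENNReal.ofReal_le_ofReal ?_
    have hx1 : ‖x‖ = 1 := by simpa using hx.2
    have := h x hx.1
    rw [norm_sq_coProj_apply, hx1]
    rw [hx1, one_pow, mul_one] at this
    have := (div_le_iff₀ (by positivity)).2 this
    linarith
  have hsup : (⨆ x ∈ (S - S) ∩ Metric.sphere (0 : H) 1, ENNReal.ofReal (‖coProj z x‖ ^ 2)) ≤
      ENNReal.ofReal 1 := by
    refine iSup₂_le fun x hx => ENNReal.ofReal_le_ofReal ?_
    have hx1 : ‖x‖ = 1 := by simpa using hx.2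
    rw [norm_sq_coProj_apply, hx1]
    have : 0 ≤ ⟪z, x⟫ ^ 2 / ‖z‖ ^ 2 := by positivity
    linarith
  have hpos : 0 < ENNReal.ofReal (1 - q) := ENNReal.ofReal_pos.2 (by linarith)
  rw [restrictedCond, if_neg (hpos.trans_le hinf).ne', ENNReal.ofReal_div_of_pos (by linarith)]
  exact ENNReal.div_le_div hsup hinf

/-- The aligned secant x pushes the infimum down to 1 - q, and the orthogonal secant y pushes the
supremum up to 1. Homogeneity of S allows both to be normalized. -/
theorem le_restrictedCond_coProj (hS : ∀ (c : ℝ), ∀ x ∈ S, c • x ∈ S) (hz : z ≠ 0) (hq : q < 1)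
    {x : H} (hx : x ∈ S - S) (hx0 : x ≠ 0) (h : q * (‖z‖ ^ 2 * ‖x‖ ^ 2) ≤ ⟪z, x⟫ ^ 2)
    {y : H} (hy : y ∈ S - S) (hy0 : y ≠ 0) (hzy : ⟪z, y⟫ = 0) :
    ENNReal.ofReal (1 / (1 - q)) ≤ restrictedCond S (coProj z) := by
  have hz0 : 0 < ‖z‖ := norm_pos_iff.2 hz
  have hmem : ∀ w ∈ S - S, w ≠ 0 → ‖w‖⁻¹ • w ∈ (S - S) ∩ Metric.sphere (0 : H) 1 := by
    rintro w ⟨a, ha, b, hb, rfl⟩ hw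
    refine ⟨⟨_, hS ‖a - b‖⁻¹ a ha, _, hS ‖a - b‖⁻¹ b hb, (smul_sub _ _ _).symm⟩, ?_⟩
    rw [mem_sphere_zero_iff_norm, norm_smul, norm_inv, norm_norm,
      inv_mul_cancel₀ (norm_ne_zero_iff.2 hw)]
  have hinf : (⨅ x ∈ (S - S) ∩ Metric.sphere (0 : H) 1, ENNReal.ofReal (‖coProj z x‖ ^ 2)) ≤
      ENNReal.ofReal (1 - q) := by
    refine iInf₂_le_of_le _ (hmem x hx hx0) (ENNReal.ofReal_le_ofReal ?_)
    have hx1 : ‖‖x‖⁻¹ • x‖ = 1 := by simpa using (hmem x hx hx0).2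
    have hxp : 0 < ‖x‖ := norm_pos_iff.2 hx0
    rw [norm_sq_coProj_apply, hx1, real_inner_smul_right]
    have : q ≤ (‖x‖⁻¹ * ⟪z, x⟫) ^ 2 / ‖z‖ ^ 2 := by
      rw [le_div_iff₀ (by positivity), mul_pow, inv_pow, inv_mul_eq_div,
        le_div_iff₀ (by positivity)]
      linarith
    linarith
  have hsup : ENNReal.ofReal 1 ≤
      ⨆ x ∈ (S - S) ∩ Metric.sphere (0 : H) 1, ENNReal.ofReal (‖coProj z x‖ ^ 2) := by
    refine le_iSup₂_of_le _ (hmem y hy hy0) (ENNReal.ofReal_le_ofReal ?_)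
    have hy1 : ‖‖y‖⁻¹ • y‖ = 1 := by simpa using (hmem y hy hy0).2
    rw [norm_sq_coProj_apply, hy1, real_inner_smul_right, hzy]
    simp
  rw [restrictedCond]
  split_ifs with h0
  · exact le_top
  · rw [ENNReal.ofReal_div_of_pos (by linarith)]
    exact ENNReal.div_le_div hsup hinf

end Constants

/-! ### Secants of the low-rank set -/

section Secant

variable {n r : ℕ}

theorem smul_mem_lowRank (c : ℝ) (A : SymMat n) (hA : A ∈ lowRank n r) : c • A ∈ lowRank n r := by
  rw [mem_lowRank_iff] at hA ⊢
  refine (Submodule.finrank_mono ?_).trans hA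
  rintro _ ⟨v, rfl⟩
  exact ⟨c • v, by simp⟩

theorem mem_lowRank_of_mem_sub {A : SymMat n} (hA : A ∈ lowRank n r - lowRank n r) :
    A ∈ lowRank n (2 * r) := by
  obtain ⟨x, hx, y, hy, rfl⟩ := hA
  change x - y ∈ _
  rw [mem_lowRank_iff] at hx hy ⊢
  have : LinearMap.range (op (x - y)) ≤ LinearMap.range (op x) ⊔ LinearMap.range (op y) := by
    rintro _ ⟨v, rfl⟩
    rw [map_sub, LinearMap.sub_apply]
    exact sub_mem (Submodule.mem_sup_left ⟨v, rfl⟩) (Submodule.mem_sup_right ⟨v, rfl⟩)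
  have := (Submodule.finrank_mono this).trans (Submodule.finrank_add_le_finrank_add_finrank _ _)
  omega

theorem diagOn_union_mem_sub {ι : Type*} [Fintype ι] [DecidableEq ι]
    (b : OrthonormalBasis ι ℝ (EuclideanSpace ℝ (Fin n))) (l : ι → ℝ) {s t : Finset ι}
    (hst : Disjoint s t) (hs : s.card ≤ r) (ht : t.card ≤ r) :
    diagOn b l (s ∪ t) ∈ lowRank n r - lowRank n r := by
  refine ⟨_, diagOn_mem_lowRank b l hs, _,
    smul_mem_lowRank (-1) _ (diagOn_mem_lowRank b l ht), ?_⟩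
  simp only [diagOn, Finset.sum_union hst, neg_smul, one_smul, sub_neg_eq_add]

/-- Every symmetric matrix of size at least two is orthogonal to a nonzero secant. -/
theorem exists_mem_sub_inner_eq_zero (hr : 1 ≤ r) (hn : 2 ≤ n) (z : SymMat n) :
    ∃ y ∈ lowRank n r - lowRank n r, y ≠ 0 ∧ ⟪z, y⟫ = 0 := by
  set e := eigBasis z
  let i : Fin n := ⟨0, by omega⟩
  let j : Fin n := ⟨1, by omega⟩
  have hij : ⟪e i, e j⟫ = 0 := e.orthonormal.2 (by simp [i, j])
  have hji : ⟪e j, e i⟫ = 0 := by rw [real_inner_comm, hij]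
  have hi : ⟪e i, e i⟫ = 1 := by rw [real_inner_self_eq_norm_sq, e.norm_eq_one, one_pow]
  have hj : ⟪e j, e j⟫ = 1 := by rw [real_inner_self_eq_norm_sq, e.norm_eq_one, one_pow]
  have hmem : ∀ v : EuclideanSpace ℝ (Fin n), outer v ∈ lowRank n r := fun v => by
    rw [mem_lowRank_iff]
    have : LinearMap.range (op (outer v)) ≤ Submodule.span ℝ {v} := by
      rintro _ ⟨u, rfl⟩
      rw [op_outer]
      exact Submodule.smul_mem _ _ (Submodule.mem_span_singleton_self v)
    exact (Submodule.finrank_mono this).trans ((finrank_span_le_card {v}).trans (by simpa using hr))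
  -- This is 2(e_i e_jᵀ + e_j e_iᵀ), off-diagonal in an eigenbasis of z and hence orthogonal to z;
  -- as a difference of two rank-one matrices it is a secant even for r = 1.
  refine ⟨outer (e i + e j) - outer (e i - e j), ⟨_, hmem _, _, hmem _, rfl⟩, fun h => ?_, ?_⟩
  · have := congrArg (fun A => ⟪e i, op A (e j)⟫) h
    simp only [map_sub, LinearMap.sub_apply, op_outer, inner_sub_right, real_inner_smul_right,
      inner_add_left, inner_sub_left, inner_add_right, hi, hj, hij, map_zero,
      LinearMap.zero_apply, inner_zero_right] at this
    norm_num at this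
  · rw [inner_sub_right, inner_outer, inner_outer]
    simp only [map_add, map_sub, e, op_eigBasis]
    simp only [inner_add_left, inner_sub_left, inner_add_right, inner_sub_right,
      real_inner_smul_right]
    change _ * ⟪e i, e i⟫ + _ * ⟪e j, e i⟫ + _ - _ = _
    simp only [e] at hi hj hij hji
    simp only [e, hi, hj, hij, hji]
    ring

/-- Inner products of a diagonal matrix with a matrix of rank at most `k`. -/
theorem inner_diagOn_sq_le {k : ℕ} {ι : Type*} [Fintype ι]
    (b : OrthonormalBasis ι ℝ (EuclideanSpace ℝ (Fin n))) (l : ι → ℝ) {Q : ℝ}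
    (hQ : ∀ p : ι → ℝ, (∀ i, 0 ≤ p i) → (∀ i, p i ≤ 1) → ∑ i, p i ≤ k → ∑ i, p i * l i ^ 2 ≤ Q)
    {x : SymMat n} (hx : x ∈ lowRank n k) :
    ⟪diagOn b l Finset.univ, x⟫ ^ 2 ≤ Q * ‖x‖ ^ 2 := by
  rw [mem_lowRank_iff] at hx
  set V := LinearMap.range (op x)
  -- Projecting b_i onto the range V of x before applying Cauchy–Schwarz produces the weights p_i =
  -- ‖P_V b_i‖², which lie in [0, 1] and sum to dim V ≤ k. Hypothesis `hQ` is the resulting linear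
  -- program.
  have hproj : ∀ i, ⟪b i, op x (b i)⟫ = ⟪V.starProjection (b i), op x (b i)⟫ := fun i => by
    rw [Submodule.inner_starProjection_left_eq_right,
      Submodule.starProjection_eq_self_iff.2 (LinearMap.mem_range_self _ _)]
  let g := stdOrthonormalBasis ℝ V
  have hp : ∀ i, ‖V.starProjection (b i)‖ ^ 2 = ∑ j, ⟪(g j : EuclideanSpace ℝ (Fin n)), b i⟫ ^ 2 :=
    fun i => by
      have : ‖V.starProjection (b i)‖ = ‖V.orthogonalProjectionOnto (b i)‖ := rfl
      rw [this, ← g.sum_sq_inner_right]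
      refine Finset.sum_congr rfl fun j _ => ?_
      rw [Submodule.inner_orthogonalProjectionOnto_eq_of_mem_left]
  have hx2 : ‖x‖ ^ 2 = ∑ i, ‖op x (b i)‖ ^ 2 := by
    rw [← real_inner_self_eq_norm_sq, inner_eq_sum b]
    simp only [real_inner_self_eq_norm_sq]
  have hsum : ∑ i, ‖V.starProjection (b i)‖ ^ 2 ≤ k := by
    simp only [hp]
    rw [Finset.sum_comm]
    simp only [b.sum_sq_inner_left]
    have : ∀ j, ‖(g j : EuclideanSpace ℝ (Fin n))‖ = 1 := fun j => g.norm_eq_one j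
    simp only [this, one_pow, Finset.sum_const, Finset.card_univ, Fintype.card_fin, nsmul_eq_mul,
      mul_one]
    exact_mod_cast hx
  have hle1 : ∀ i, ‖V.starProjection (b i)‖ ^ 2 ≤ 1 := fun i => by
    refine pow_le_one₀ (norm_nonneg _) ?_
    rw [← b.norm_eq_one i]
    exact V.norm_starProjection_apply_le _
  calc ⟪diagOn b l Finset.univ, x⟫ ^ 2
      = (∑ i, l i * ⟪V.starProjection (b i), op x (b i)⟫) ^ 2 := by
        rw [inner_diagOn]; simp only [hproj]
    _ ≤ (∑ i, (|l i| * ‖V.starProjection (b i)‖) * ‖op x (b i)‖) ^ 2 := by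
        refine sq_le_sq.2 ((Finset.abs_sum_le_sum_abs _ _).trans ?_)
        refine le_trans (Finset.sum_le_sum fun i _ => ?_) (le_abs_self _)
        rw [abs_mul, mul_assoc]
        exact mul_le_mul_of_nonneg_left (abs_real_inner_le_norm _ _) (abs_nonneg _)
    _ ≤ (∑ i, (|l i| * ‖V.starProjection (b i)‖) ^ 2) * ∑ i, ‖op x (b i)‖ ^ 2 :=
        Finset.sum_mul_sq_le_sq_mul_sq _ _ _
    _ ≤ Q * ‖x‖ ^ 2 := by
        rw [← hx2]
        refine mul_le_mul_of_nonneg_right (le_trans (le_of_eq ?_)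
          (hQ _ (fun i => sq_nonneg ‖V.starProjection (b i)‖) hle1 hsum)) (sq_nonneg _)
        refine Finset.sum_congr rfl fun i _ => ?_
        rw [mul_pow, sq_abs, mul_comm]

end Secant

/-! ### Descent directions: the bound for all convex functions and the nuclear norm -/

section Convex

/-- A convex function at a sum is dominated by its value at a rescaled sum over some `r`-subset. -/
theorem exists_subset_convex_le {H : Type*} [AddCommGroup H] [Module ℝ H] {R : H → ℝ}
    (hR : ConvexOn ℝ Set.univ R) {ι : Type*} [DecidableEq ι] (J : Finset ι) (f : ι → H) {r : ℕ}
    (hr : 1 ≤ r) (hrJ : r ≤ J.card) :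
    ∃ I ⊆ J, I.card = r ∧ R (∑ i ∈ J, f i) ≤ R (((J.card : ℝ) / r) • ∑ i ∈ I, f i) := by
  have hr0 : (0 : ℝ) < r := by exact_mod_cast hr
  have hC : (0 : ℝ) < J.card.choose r := by exact_mod_cast Nat.choose_pos hrJ
  obtain ⟨I, hI, h⟩ := hR.exists_ge_of_centerMass (t := Finset.powersetCard r J)
    (w := fun _ => (1 : ℝ)) (p := fun I => ((J.card : ℝ) / r) • ∑ i ∈ I, f i)
    (fun _ _ => zero_le_one) (by simpa using Nat.choose_pos hrJ) (fun _ _ => Set.mem_univ _)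
  rw [Finset.mem_powersetCard] at hI
  refine ⟨I, hI.1, hI.2, ?_⟩
  -- Each index lies in C(|J| - 1, r - 1) of the r-subsets, so the factor |J|/r makes the uniform
  -- average equal to the full sum.
  have hcount : ∑ I ∈ Finset.powersetCard r J, ∑ i ∈ I, f i =
      ((J.card - 1).choose (r - 1) : ℝ) • ∑ i ∈ J, f i := by
    have : ∀ I ∈ Finset.powersetCard r J, ∑ i ∈ I, f i = ∑ i ∈ J, if i ∈ I then f i else 0 := by
      intro I hI
      rw [← Finset.sum_filter, Finset.filter_mem_eq_inter,
        Finset.inter_eq_right.2 (Finset.mem_powersetCard.1 hI).1]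
    rw [Finset.sum_congr rfl this, Finset.sum_comm, Finset.smul_sum]
    refine Finset.sum_congr rfl fun i hi => ?_
    have hc := Finset.card_filter_powersetCard_subset {i} J r (by simpa using hi) (by simpa using hr)
    simp only [Finset.singleton_subset_iff, Finset.card_singleton] at hc
    rw [← Finset.sum_filter, Finset.sum_const, hc, Nat.cast_smul_eq_nsmul]
  have hmul : (J.card : ℝ) * (J.card - 1).choose (r - 1) = r * J.card.choose r := by
    obtain ⟨a, ha⟩ : ∃ a, J.card = a + 1 := ⟨J.card - 1, by omega⟩
    obtain ⟨c, rfl⟩ : ∃ c, r = c + 1 := ⟨r - 1, by omega⟩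
    rw [ha]
    have := Nat.add_one_mul_choose_eq a c
    simp only [Nat.add_sub_cancel]
    rw [mul_comm ((c + 1 : ℕ) : ℝ)]
    exact_mod_cast this
  simp only [Finset.centerMass, ← Finset.smul_sum, hcount, smul_smul, Finset.sum_const,
    Finset.card_powersetCard, nsmul_eq_mul, mul_one, one_mul] at h
  have : ((J.card.choose r : ℝ))⁻¹ * ((J.card : ℝ) / r * (J.card - 1).choose (r - 1)) = 1 := by
    rw [div_mul_eq_mul_div, hmul]
    field_simp
  rwa [this, one_smul] at h

variable {n r : ℕ}

/-- Every convex function has a descent direction that is nearly orthogonal to all secants. -/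
theorem exists_descent_direction (hr : 1 ≤ r) (hrn : 2 * r < n) {R : SymMat n → ℝ}
    (hR : ConvexOn ℝ Set.univ R) :
    ∃ z ∈ descentCone R (lowRank n r), z ≠ 0 ∧ ∀ x ∈ lowRank n r - lowRank n r,
      ⟪z, x⟫ ^ 2 ≤ (Bstar r n + 1)⁻¹ * (‖z‖ ^ 2 * ‖x‖ ^ 2) := by
  obtain ⟨L, hL1, hL2, hB⟩ := exists_Bfun_eq_Bstar hrn
  have hr0 : (0 : ℝ) < r := by exact_mod_cast hr
  have hL0 : (0 : ℝ) < L := by exact_mod_cast hL1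
  let b := EuclideanSpace.basisFun (Fin n) ℝ
  obtain ⟨J, -, hJ⟩ := Finset.exists_subset_card_eq (s := (Finset.univ : Finset (Fin n)))
    (n := L + 2 * r) (by simp; omega)
  obtain ⟨I, hIJ, hI, hle⟩ := exists_subset_convex_le hR J (fun i => outer (b i)) hr (by omega)
  set a : ℝ := L / r + 1 with ha
  have ha1 : 1 ≤ a := by
    have : 0 < (L : ℝ) / r := by positivity
    linarith
  have hc : ((J.card : ℝ) / r) = a + 1 := by
    rw [hJ, ha]; push_cast; field_simp; ring
  -- Eigenvalues of the projection onto J minus the scaled projection onto I: -a on I, 1 on J \ I,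
  -- and 0 elsewhere.
  set l : Fin n → ℝ := fun i => (if i ∈ J then 1 else 0) - (if i ∈ I then a + 1 else 0) with hl
  have hlI : ∀ i ∈ I, l i ^ 2 = a ^ 2 := fun i hi => by
    simp [hl, hi, hIJ hi]
  have hlJ : ∀ i ∈ J \ I, l i ^ 2 = 1 := fun i hi => by
    rw [Finset.mem_sdiff] at hi
    simp [hl, hi.1, hi.2]
  have hl0 : ∀ i ∉ J, l i = 0 := fun i hi => by
    simp [hl, hi, mt (@hIJ i) hi]
  set z := diagOn b l Finset.univ with hz
  set x₀ := ((J.card : ℝ) / r) • ∑ i ∈ I, outer (b i) with hx₀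
  have hzx : x₀ + z = ∑ i ∈ J, outer (b i) := by
    simp only [hz, diagOn, hl, sub_smul, Finset.sum_sub_distrib, ite_smul, one_smul, zero_smul,
      Finset.sum_ite_mem, Finset.univ_inter, hx₀, hc, Finset.smul_sum]
    abel
  have hx₀mem : x₀ ∈ lowRank n r := by
    rw [hx₀]
    refine smul_mem_lowRank _ _ ?_
    have := diagOn_mem_lowRank b (fun _ => (1 : ℝ)) hI.le
    simpa [diagOn] using this
  have hznorm : ‖z‖ ^ 2 = r * a ^ 2 + r + L := by
    rw [hz, norm_sq_diagOn, ← Finset.sum_subset (Finset.subset_univ J) fun i _ hi => by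
      rw [hl0 i hi, zero_pow two_ne_zero], ← Finset.sum_sdiff hIJ, Finset.sum_congr rfl hlI,
      Finset.sum_congr rfl hlJ]
    simp [Finset.card_sdiff_of_subset hIJ, hI, hJ]
    rw [Nat.cast_sub (by omega)]
    push_cast
    ring
  have hz0 : z ≠ 0 := by
    rw [← norm_ne_zero_iff]
    intro h
    rw [h] at hznorm
    have : 0 < (r : ℝ) * a ^ 2 + r + L := by positivity
    norm_num at hznorm
    linarith
  refine ⟨z, Set.mem_iUnion₂.2 ⟨x₀, hx₀mem, 1, z, by rw [hzx]; exact hle, (one_smul _ _).symm⟩,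
    hz0, fun x hx => ?_⟩
  have hQ := inner_diagOn_sq_le (k := 2 * r) b l (Q := r * a ^ 2 + r) ?_ (mem_lowRank_of_mem_sub hx)
  · refine hQ.trans (le_of_eq ?_)
    rw [hznorm, ← mul_assoc, ← hB, Bfun, ← ha]
    have : (0 : ℝ) < a ^ 2 + 1 := by positivity
    congr 1
    field_simp
    ring
  · intro p hp0 hp1 hp
    -- Charging a² - 1 in full on each index of I leaves weight at most 1 per unit of p, so the
    -- total is at most 2r + r(a² - 1) = r a² + r.
    have h1 : ∑ i, p i * l i ^ 2 ≤ ∑ i, (p i + if i ∈ I then a ^ 2 - 1 else 0) := by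
      refine Finset.sum_le_sum fun i _ => ?_
      by_cases hi : i ∈ I
      · rw [hlI i hi, if_pos hi]
        nlinarith [hp1 i, hp0 i, mul_nonneg (sub_nonneg.2 (hp1 i))
          (by nlinarith : (0 : ℝ) ≤ a ^ 2 - 1)]
      · rw [if_neg hi, add_zero]
        by_cases hiJ : i ∈ J
        · rw [hlJ i (Finset.mem_sdiff.2 ⟨hiJ, hi⟩), mul_one]
        · rw [hl0 i hiJ]; simpa using hp0 i
    rw [Finset.sum_add_distrib, Finset.sum_ite_mem, Finset.univ_inter, Finset.sum_const, hI,
      nsmul_eq_mul] at h1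
    push_cast at hp
    linarith

/-- Every descent direction of the nuclear norm is well aligned with some secant. -/
theorem exists_secant_of_mem_descentCone (hr : 1 ≤ r) (hrn : 2 * r < n) {w : SymMat n}
    (hw : w ∈ descentCone nuclearNorm (lowRank n r)) (hw0 : w ≠ 0) :
    ∃ x ∈ lowRank n r - lowRank n r, x ≠ 0 ∧
      (Bstar r n + 1)⁻¹ * (‖w‖ ^ 2 * ‖x‖ ^ 2) ≤ ⟪w, x⟫ ^ 2 := by
  have hB := Bstar_pos hr hrn
  obtain ⟨x₀, hx₀, γ, z, hz, rfl⟩ := Set.mem_iUnion₂.1 hw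
  obtain ⟨y, rfl⟩ : ∃ y, z = -y := ⟨-z, (neg_neg z).symm⟩
  rw [← sub_eq_add_neg] at hz
  have hsum := (sum_abs_eig_sub_le x₀ y).trans hz
  rw [nuclearNorm_eq] at hsum
  set I := Finset.univ.filter fun i => eig x₀ i ≠ 0 with hI
  -- The null-space-property argument: off I the eigenvalues of x₀ vanish, so those of y add to the
  -- ℓ¹ distance in full, and on I the distance can drop below the norm of x₀ by at most the mass of
  -- y there.
  have hdom : ∑ i ∈ Iᶜ, |eig y i| ≤ ∑ i ∈ I, |eig y i| := by
    have h : ∀ i ∈ Iᶜ, eig x₀ i = 0 := fun i hi => by simpa [hI] using hi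
    have hl : ∑ i ∈ Iᶜ, |eig x₀ i - eig y i| = ∑ i ∈ Iᶜ, |eig y i| :=
      Finset.sum_congr rfl fun i hi => by rw [h i hi, zero_sub, abs_neg]
    have hr : ∑ i ∈ Iᶜ, |eig x₀ i| = 0 := Finset.sum_eq_zero fun i hi => by rw [h i hi, abs_zero]
    rw [← Finset.sum_add_sum_compl I, ← Finset.sum_add_sum_compl I (fun i => |eig x₀ i|),
      hl, hr] at hsum
    have : ∑ i ∈ I, |eig x₀ i| ≤ ∑ i ∈ I, |eig x₀ i - eig y i| + ∑ i ∈ I, |eig y i| := by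
      rw [← Finset.sum_add_distrib]
      refine Finset.sum_le_sum fun i _ => ?_
      linarith [abs_sub_abs_le_abs_sub (eig x₀ i) (eig y i)]
    linarith
  obtain ⟨T₀, T₁, hdisj, h0, h1, hT⟩ := exists_sum_sq_compl_le hr hrn (fun i => |eig y i|)
    (fun i => abs_nonneg _) I (card_eig_ne_zero_le hx₀) hdom
  simp only [sq_abs] at hT
  -- Truncating y in its own eigenbasis is an orthogonal projection, so `⟪y, x⟫ = ‖x‖²` and the
  -- alignment is `‖x‖² / ‖y‖²`.
  set x := diagOn (eigBasis y) (eig y) (T₀ ∪ T₁) with hx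
  have hxnorm : ‖x‖ ^ 2 = ∑ i ∈ T₀ ∪ T₁, eig y i ^ 2 := norm_sq_diagOn _ _ _
  have hynorm : ‖y‖ ^ 2 = ‖x‖ ^ 2 + ∑ i ∈ (T₀ ∪ T₁)ᶜ, eig y i ^ 2 := by
    conv_lhs => rw [← diagOn_eig y, norm_sq_diagOn]
    rw [hxnorm, Finset.sum_add_sum_compl]
  have hinner : ⟪y, x⟫ = ‖x‖ ^ 2 := by
    rw [real_inner_comm, hx, inner_diagOn, ← hx, hxnorm]
    refine Finset.sum_congr rfl fun i _ => ?_
    rw [op_eigBasis, real_inner_smul_right, real_inner_self_eq_norm_sq,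
      (eigBasis y).norm_eq_one]
    ring
  have hle : ‖y‖ ^ 2 ≤ (Bstar r n + 1) * ‖x‖ ^ 2 := by
    rw [hynorm]
    nth_rw 2 [hxnorm]
    rw [add_mul, one_mul, hxnorm]
    linarith
  refine ⟨x, diagOn_union_mem_sub _ _ hdisj h0.le h1.le, fun hx0 => hw0 ?_, ?_⟩
  · rw [hx0, norm_zero] at hle
    have : y = 0 := by
      rw [← norm_eq_zero]
      exact pow_eq_zero_iff two_ne_zero |>.1 (le_antisymm (by simpa using hle) (sq_nonneg _))
    simp [this]
  · rw [smul_neg, norm_neg, norm_smul, inner_neg_left, neg_sq]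
    have e : ⟪γ • y, x⟫ = γ * ‖x‖ ^ 2 := by rw [← hinner]; exact real_inner_smul_left y x γ
    rw [e, mul_pow, Real.norm_eq_abs, sq_abs, inv_mul_le_iff₀ (by linarith)]
    have := mul_le_mul_of_nonneg_left hle (by positivity : 0 ≤ γ ^ 2 * ‖x‖ ^ 2)
    linarith

end Convex

end LowRank

end

theorem mainTheorem2 (n r : ℕ) (hr : 1 ≤ r) (hrn : 2 * r < n) :
    (LowRank.nuclearNorm (n := n)) ∈ LowRank.regularizers (LowRank.SymMat n) ∧
    LowRank.deltaNec (LowRank.lowRank n r) LowRank.nuclearNorm =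
      (⨆ R ∈ LowRank.regularizers (LowRank.SymMat n),
        LowRank.deltaNec (LowRank.lowRank n r) R) ∧
    (⨆ R ∈ LowRank.regularizers (LowRank.SymMat n),
        LowRank.deltaNec (LowRank.lowRank n r) R) =
      ENNReal.ofReal (2 * LowRank.Bstar r n + 1)⁻¹ ∧
    LowRank.deltaNecUnscaled (LowRank.lowRank n r) LowRank.nuclearNorm =
      (⨆ R ∈ LowRank.regularizers (LowRank.SymMat n),
        LowRank.deltaNecUnscaled (LowRank.lowRank n r) R) ∧
    (⨆ R ∈ LowRank.regularizers (LowRank.SymMat n),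
        LowRank.deltaNecUnscaled (LowRank.lowRank n r) R) =
      ENNReal.ofReal (LowRank.Bstar r n + 1)⁻¹ := by
  open LowRank in
  have hB := Bstar_pos hr hrn
  have hq : (Bstar r n + 1)⁻¹ < 1 := inv_lt_one_of_one_lt₀ (by linarith)
  have hmem := nuclearNorm_mem_regularizers (n := n)
  have up : ∀ R ∈ regularizers (SymMat n),
      deltaNec (lowRank n r) R ≤ ENNReal.ofReal (2 * Bstar r n + 1)⁻¹ := fun R hR => by
    obtain ⟨z, hz, hz0, h⟩ := exists_descent_direction hr hrn hR.1
    rw [← ripOfCond_ofReal hB]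
    exact ripOfCond_mono (iInf₂_le_of_le z ⟨hz, hz0⟩ (restrictedCond_coProj_le hz0 hq h))
  have up' : ∀ R ∈ regularizers (SymMat n),
      deltaNecUnscaled (lowRank n r) R ≤ ENNReal.ofReal (Bstar r n + 1)⁻¹ := fun R hR => by
    obtain ⟨z, hz, hz0, h⟩ := exists_descent_direction hr hrn hR.1
    exact iInf₂_le_of_le z ⟨hz, hz0⟩ (ripConst_coProj_le hz0 h)
  have low : ENNReal.ofReal (2 * Bstar r n + 1)⁻¹ ≤
      deltaNec (lowRank n r) (nuclearNorm (n := n)) := by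
    rw [← ripOfCond_ofReal hB]
    refine ripOfCond_mono (le_iInf₂ fun z hz => ?_)
    obtain ⟨x, hx, hx0, h⟩ := exists_secant_of_mem_descentCone hr hrn hz.1 hz.2
    obtain ⟨y, hy, hy0, hzy⟩ := exists_mem_sub_inner_eq_zero hr (by omega) z
    exact le_restrictedCond_coProj smul_mem_lowRank hz.2 hq hx hx0 h hy hy0 hzy
  have low' : ENNReal.ofReal (Bstar r n + 1)⁻¹ ≤
      deltaNecUnscaled (lowRank n r) (nuclearNorm (n := n)) := by
    refine le_iInf₂ fun z hz => ?_
    obtain ⟨x, hx, hx0, h⟩ := exists_secant_of_mem_descentCone hr hrn hz.1 hz.2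
    exact le_ripConst_coProj hz.2 hx hx0 h
  have e := le_antisymm (iSup₂_le up)
    (low.trans (le_iSup₂ (f := fun R _ => deltaNec (lowRank n r) R) _ hmem))
  have e' := le_antisymm (iSup₂_le up')
    (low'.trans (le_iSup₂ (f := fun R _ => deltaNecUnscaled (lowRank n r) R) _ hmem))
  exact ⟨hmem, (le_antisymm (up _ hmem) low).trans e.symm, e,
    (le_antisymm (up' _ hmem) low').trans e'.symm, e'⟩
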